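/- Let $\Bbbk$ be a field of characteristic $0$ and $H=\Bbbk[D]$, with coproduct $\Delta(D)=D\otimes 1+1\otimes D$ and iterated coproducts $\Delta^{(n)}:H\to H^{\otimes n}$; $H^{\otimes n}$ is a right $H$-module via $F\cdot h=F\,\Delta^{(n)}(h)$. A conformal algebra is a unital left $H$-module $C$ with $\Bbbk$-bilinear operations $a_{(n)}b$, $n\ge 0$, such that for all $a,b\in C$: $a_{(n)}b=0$ for all sufficiently large $n$, and $Da_{(n)}b=-n\,a_{(n-1)}b$, $a_{(n)}Db=D(a_{(n)}b)+n\,a_{(n-1)}b$ for $n\ge 0$. Its coefficient algebra is $\operatorname{Coeff} C=\Bbbk[t,t^{-1}]\otimes_H C$, where $t^nD=-n\,t^{n-1}$, with the product $$a(n)\,b(m)=\sum_{s\ge 0}\binom{n}{s}(a_{(s)}b)(n+m-s),\qquad a(n)=t^n\otimes_H a,\quad n,m\in\mathbb Z .$$ A conformal algebra $C$ is called left (respectively right) alternative if the algebra $A=\operatorname{Coeff} C$ is, that is, if $(xx)y=x(xy)$ (respectively $x(yy)=(xy)y$) for all $x,y\in A$. The pseudoproduct of $a,b\in C$ is $$a*b=\sum_{s\ge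 0}\Big(\frac{(-D)^s}{s!}\otimes 1\Big)\otimes_H (a_{(s)}b)\in H^{\otimes 2}\otimes_H C,$$ and it is extended to $*:(H^{\otimes n}\otimes_H C)\times(H^{\otimes m}\otimes_H C)\to H^{\otimes (n+m)}\otimes_H C$ by $$(F\otimes_H a)*(G\otimes_H b)=(F\otimes G\otimes_H 1)\,(\Delta^{(n)}\otimes\Delta^{(m)}\otimes_H\mathrm{id}_C)(a*b),$$ where $a\in C$ is identified with $1\otimes_H a\in H\otimes_H C$. Let $\sigma_{ij}$ be the permutation of the $i$-th and $j$-th tensor factors of $H^{\otimes 3}$. Then for every conformal algebra $C$ over $\Bbbk$: (i) $C$ is left alternative if and only if for all $a,b,c\in C$ $$a*(b*c)-(a*b)*c=(\sigma_{12}\otimes_H \mathrm{id}_C)\big((b*a)*c-b*(a*c)\big);$$ (ii) $C$ is right alternative if and only if for all $a,b,c\in C$ $$a*(b*c)-(a*b)*c=(\sigma_{23}\otimes_H \mathrm{id}_C)\big((a*c)*b-a*(c*b)\big).$$ -/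

import Mathlib

open scoped Polynomial TensorProduct

set_option linter.unusedSectionVars false

namespace ConformalAlg

noncomputable section

universe u v

/-! ### Tensor products over `H = 𝕜[D]`

The variable `X` of `k[X]` plays the role of `D`. -/

section Lift

variable {k : Type*} [Field k]
variable {M N M' N' P : Type*}
variable [AddCommGroup M] [Module k M] [Module k[X] M] [IsScalarTower k k[X] M]
variable [AddCommGroup N] [Module k N] [Module k[X] N] [IsScalarTower k k[X] N]
variable [AddCommGroup M'] [Module k M'] [Module k[X] M'] [IsScalarTower k k[X] M']
variable [AddCommGroup N'] [Module k N'] [Module k[X] N'] [IsScalarTower k k[X] N']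
variable [AddCommGroup P] [Module k P]

theorem balanced_of_X (f : M →ₗ[k] N →ₗ[k] P)
    (hf : ∀ m n, f ((Polynomial.X : k[X]) • m) n = f m ((Polynomial.X : k[X]) • n))
    (p : k[X]) (m : M) (n : N) : f (p • m) n = f m (p • n) := by
  induction p using Polynomial.induction_on generalizing m n with
  | C a =>
    have h1 : (Polynomial.C a : k[X]) • m = a • m := algebraMap_smul k[X] a m
    have h2 : (Polynomial.C a : k[X]) • n = a • n := algebraMap_smul k[X] a n
    rw [h1, h2]; simp
  | add p q hp hq => simp [add_smul, hp, hq]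
  | monomial i a ih => rw [pow_succ, ← mul_assoc, mul_smul, ih, hf, ← mul_smul, mul_comm]

/-- A `k`-bilinear map which is balanced with respect to `D` factors through `⊗_H`. -/
def liftX (f : M →ₗ[k] N →ₗ[k] P)
    (hf : ∀ m n, f ((Polynomial.X : k[X]) • m) n = f m ((Polynomial.X : k[X]) • n)) :
    M ⊗[k[X]] N →ₗ[k] P where
  toFun := TensorProduct.liftAddHom (R := k[X])
    (AddMonoidHom.comp LinearMap.toAddMonoidHom' f.toAddMonoidHom) (balanced_of_X f hf)
  map_add' := map_add _
  map_smul' c x := by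
    induction x using TensorProduct.induction_on with
    | zero => simp
    | tmul m n =>
      rw [TensorProduct.smul_tmul']
      change f (c • m) n = c • f m n
      simp
    | add x y hx hy => simp only [smul_add, map_add, hx, hy]

@[simp]
theorem liftX_tmul (f : M →ₗ[k] N →ₗ[k] P)
    (hf : ∀ m n, f ((Polynomial.X : k[X]) • m) n = f m ((Polynomial.X : k[X]) • n))
    (m : M) (n : N) : liftX f hf (m ⊗ₜ n) = f m n := rfl

theorem hom_ext_tmul {f g : M ⊗[k[X]] N →ₗ[k] P} (h : ∀ m n, f (m ⊗ₜ n) = g (m ⊗ₜ n)) :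
    f = g := by
  ext x
  induction x using TensorProduct.induction_on with
  | zero => simp
  | tmul m n => exact h m n
  | add x y hx hy => simp only [map_add, hx, hy]

/-- A `k`-multilinear map of four arguments, balanced with respect to `D` in the first two and in
the last two of them, as a bilinear map on the tensor products over `H`. -/
def liftX₂ (f : M →ₗ[k] N →ₗ[k] M' →ₗ[k] N' →ₗ[k] P)
    (h₁ : ∀ m n m' n', f ((Polynomial.X : k[X]) • m) n m' n'
      = f m ((Polynomial.X : k[X]) • n) m' n')
    (h₂ : ∀ m n m' n', f m n ((Polynomial.X : k[X]) • m') n'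
      = f m n m' ((Polynomial.X : k[X]) • n')) :
    M ⊗[k[X]] N →ₗ[k] M' ⊗[k[X]] N' →ₗ[k] P :=
  liftX
    (LinearMap.mk₂ k (fun m n => liftX (f m n) (h₂ m n))
      (fun _ _ _ => hom_ext_tmul fun _ _ => by simp)
      (fun _ _ _ => hom_ext_tmul fun _ _ => by simp)
      (fun _ _ _ => hom_ext_tmul fun _ _ => by simp)
      (fun _ _ _ => hom_ext_tmul fun _ _ => by simp))
    (fun m n => hom_ext_tmul fun m' n' => by simpa using h₁ m n m' n')

@[simp]
theorem liftX₂_tmul (f : M →ₗ[k] N →ₗ[k] M' →ₗ[k] N' →ₗ[k] P) (h₁) (h₂)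
    (m : M) (n : N) (m' : M') (n' : N') :
    liftX₂ f h₁ h₂ (m ⊗ₜ n) (m' ⊗ₜ n') = f m n m' n' := rfl

end Lift

/-! ### The tensor powers of `H` -/

section HTensor

variable (k : Type u) [Field k]

/-- The algebra `H^{⊗ n}` over `k`, where `H = k[D]`. -/
def HTensor (n : ℕ) : Type u := ⨂[k]^n k[X]

instance (n : ℕ) : CommRing (HTensor k n) :=
  inferInstanceAs (CommRing (⨂[k] _ : Fin n, k[X]))

instance (n : ℕ) : Algebra k (HTensor k n) :=
  inferInstanceAs (Algebra k (⨂[k] _ : Fin n, k[X]))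

variable {k}

/-- The pure tensor `h 0 ⊗ ⋯ ⊗ h (n - 1)`. -/
def pureT {n : ℕ} (h : Fin n → k[X]) : HTensor k n := PiTensorProduct.tprod k h

theorem pure_mul {n : ℕ} (h g : Fin n → k[X]) : pureT h * pureT g = pureT (h * g) :=
  PiTensorProduct.tprod_mul_tprod h g

theorem pure_one {n : ℕ} : pureT (1 : Fin n → k[X]) = 1 := rfl

theorem HTensor.induction {n : ℕ} {p : HTensor k n → Prop} (F : HTensor k n)
    (hp : ∀ (c : k) (h : Fin n → k[X]), p (c • pureT h)) (ha : ∀ F G, p F → p G → p (F + G)) :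
    p F :=
  PiTensorProduct.induction_on F hp ha

theorem HTensor.ext {n : ℕ} {P : Type*} [AddCommGroup P] [Module k P]
    {f g : HTensor k n →ₗ[k] P} (h : ∀ a, f (pureT a) = g (pureT a)) : f = g :=
  PiTensorProduct.ext (MultilinearMap.ext h)

variable (k)

/-- `1 ⊗ ⋯ ⊗ p ⊗ ⋯ ⊗ 1` with `p` at the place `i`. -/
def single {n : ℕ} (i : Fin n) : k[X] →ₐ[k] HTensor k n :=
  PiTensorProduct.singleAlgHom (A := fun _ : Fin n => k[X]) i

theorem single_apply {n : ℕ} (i : Fin n) (p : k[X]) :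
    single k i p = pureT (Pi.mulSingle i p) := rfl

/-- The iterated coproduct `Δ^{(n)} : H → H^{⊗ n}`, the homomorphism of algebras that sends `D` to
`D ⊗ 1 ⊗ ⋯ ⊗ 1 + 1 ⊗ D ⊗ ⋯ ⊗ 1 + ⋯ + 1 ⊗ ⋯ ⊗ 1 ⊗ D`. -/
def coprod (n : ℕ) : k[X] →ₐ[k] HTensor k n :=
  Polynomial.aeval (∑ i : Fin n, single k i Polynomial.X)

theorem coprod_X (n : ℕ) : coprod k n Polynomial.X = ∑ i : Fin n, single k i Polynomial.X := by
  simp [coprod]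

/-- `H^{⊗ n}` as an `H`-module, with `F h = F Δ^{(n)}(h)`. -/
instance (n : ℕ) : Algebra k[X] (HTensor k n) := (coprod k n).toRingHom.toAlgebra

theorem smul_def {n : ℕ} (p : k[X]) (F : HTensor k n) : p • F = coprod k n p * F := rfl

instance (n : ℕ) : IsScalarTower k k[X] (HTensor k n) :=
  IsScalarTower.of_algebraMap_eq fun c => ((coprod k n).commutes c).symm

/-- The juxtaposition `F ⊗ G` of `F ∈ H^{⊗ n}` and `G ∈ H^{⊗ m}`. -/
def juxt {n m : ℕ} : HTensor k n →ₗ[k] HTensor k m →ₗ[k] HTensor k (n + m) :=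
  (TensorProduct.mk k (⨂[k]^n k[X]) (⨂[k]^m k[X])).compr₂
    (TensorPower.mulEquiv : _ ≃ₗ[k] ⨂[k]^(n + m) k[X]).toLinearMap

theorem juxt_pure {n m : ℕ} (f : Fin n → k[X]) (g : Fin m → k[X]) :
    juxt k (pureT f) (pureT g) = pureT (Fin.append f g) :=
  TensorPower.tprod_mul_tprod k f g

theorem juxt_mul {n m : ℕ} (F F' : HTensor k n) (G G' : HTensor k m) :
    juxt k F G * juxt k F' G' = juxt k (F * F') (G * G') := by
  induction F using HTensor.induction with
  | ha F₁ F₂ h₁ h₂ => simp only [map_add, LinearMap.add_apply, add_mul, h₁, h₂]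
  | hp a f =>
  induction F' using HTensor.induction with
  | ha F₁ F₂ h₁ h₂ => simp only [map_add, LinearMap.add_apply, mul_add, h₁, h₂]
  | hp a' f' =>
  induction G using HTensor.induction with
  | ha F₁ F₂ h₁ h₂ => simp only [map_add, add_mul, h₁, h₂]
  | hp b g =>
  induction G' using HTensor.induction with
  | ha F₁ F₂ h₁ h₂ => simp only [map_add, mul_add, h₁, h₂]
  | hp b' g' =>
  have : Fin.append f g * Fin.append f' g' = Fin.append (f * f') (g * g') := by
    ext1 i; refine Fin.addCases (fun i => ?_) (fun i => ?_) i <;> simp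
  simp only [map_smul, LinearMap.smul_apply, smul_mul_assoc, mul_smul_comm, juxt_pure, pure_mul,
    this, smul_smul]
  ring_nf

theorem juxt_one {n m : ℕ} : juxt k (1 : HTensor k n) (1 : HTensor k m) = 1 := by
  rw [← pure_one, ← pure_one, juxt_pure, ← pure_one]
  congr 1
  ext1 i; refine Fin.addCases (fun i => ?_) (fun i => ?_) i <;> simp

/-- The map `Δ^{(n)} ⊗ Δ^{(m)} : H ⊗ H → H^{⊗ (n + m)}`. -/
def splitCoprod (n m : ℕ) : HTensor k 2 →ₐ[k] HTensor k (n + m) :=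
  PiTensorProduct.liftAlgHom (A := fun _ : Fin 2 => k[X])
    { toFun := fun h => juxt k (coprod k n (h 0)) (coprod k m (h 1))
      map_update_add' := by
        intro _ h i x y
        fin_cases i <;> simp [Function.update]
      map_update_smul' := by
        intro _ h i c x
        fin_cases i <;> simp [Function.update] }
    (by simp [juxt_one])
    (fun x y => by simp [juxt_mul])

theorem splitCoprod_pure (n m : ℕ) (h : Fin 2 → k[X]) :
    splitCoprod k n m (pureT h) = juxt k (coprod k n (h 0)) (coprod k m (h 1)) :=
  PiTensorProduct.lift.tprod h

theorem splitCoprod_coprod (n m : ℕ) (p : k[X]) :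
    splitCoprod k n m (coprod k 2 p) = coprod k (n + m) p := by
  have key : (splitCoprod k n m).comp (coprod k 2) = coprod k (n + m) := by
    apply Polynomial.algHom_ext
    rw [AlgHom.comp_apply, coprod_X, coprod_X, map_sum, Fin.sum_univ_two, Fin.sum_univ_add]
    simp only [single_apply, splitCoprod_pure]
    have e₁ : ∀ i : Fin n, pureT (Pi.mulSingle (Fin.castAdd m i) (Polynomial.X : k[X]))
        = juxt k (single k i Polynomial.X) 1 := by
      intro i
      rw [single_apply, ← pure_one, juxt_pure]
      congr 1
      ext1 j
      refine Fin.addCases (fun j => ?_) (fun j => ?_) j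
      · simp [Pi.mulSingle_apply]
      · simp [Pi.mulSingle_apply, Fin.ext_iff]; omega
    have e₂ : ∀ i : Fin m, pureT (Pi.mulSingle (Fin.natAdd n i) (Polynomial.X : k[X]))
        = juxt k 1 (single k i Polynomial.X) := by
      intro i
      rw [single_apply, ← pure_one, juxt_pure]
      congr 1
      ext1 j
      refine Fin.addCases (fun j => ?_) (fun j => ?_) j
      · simp [Pi.mulSingle_apply, Fin.ext_iff]; omega
      · simp [Pi.mulSingle_apply]
    simp [e₁, e₂, coprod_X]
  exact DFunLike.congr_fun key p

/-- `Δ^{(n)} ⊗ Δ^{(m)}` as an `H`-linear map. -/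
def splitCoprodH (n m : ℕ) : HTensor k 2 →ₗ[k[X]] HTensor k (n + m) where
  toFun := splitCoprod k n m
  map_add' := map_add _
  map_smul' p F := by simp [smul_def, splitCoprod_coprod]

/-- The permutation `σ` of the tensor factors of `H^{⊗ n}`: the factor at the place `i` is moved
to the place `σ i`. -/
def permFactors {n : ℕ} (σ : Equiv.Perm (Fin n)) : HTensor k n →ₗ[k] HTensor k n :=
  (PiTensorProduct.reindex k (fun _ : Fin n => k[X]) σ).toLinearMap

theorem permFactors_pure {n : ℕ} (σ : Equiv.Perm (Fin n)) (h : Fin n → k[X]) :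
    permFactors k σ (pureT h) = pureT (fun i => h (σ.symm i)) :=
  PiTensorProduct.reindex_tprod σ h

theorem permFactors_mul {n : ℕ} (σ : Equiv.Perm (Fin n)) (F G : HTensor k n) :
    permFactors k σ (F * G) = permFactors k σ F * permFactors k σ G := by
  induction F using HTensor.induction with
  | ha F₁ F₂ h₁ h₂ => simp only [map_add, add_mul, h₁, h₂]
  | hp a f =>
  induction G using HTensor.induction with
  | ha F₁ F₂ h₁ h₂ => simp only [map_add, mul_add, h₁, h₂]
  | hp b g =>
  simp only [smul_mul_smul_comm, pure_mul, map_smul, permFactors_pure]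
  rfl

theorem permFactors_one {n : ℕ} (σ : Equiv.Perm (Fin n)) : permFactors k σ 1 = 1 := by
  rw [← pure_one, permFactors_pure]
  rfl

theorem permFactors_coprod {n : ℕ} (σ : Equiv.Perm (Fin n)) (p : k[X]) :
    permFactors k σ (coprod k n p) = coprod k n p := by
  have key : (AlgHom.ofLinearMap (permFactors k σ) (permFactors_one k σ)
      (permFactors_mul k σ)).comp (coprod k n) = coprod k n := by
    apply Polynomial.algHom_ext
    rw [AlgHom.comp_apply, coprod_X, map_sum]
    refine Eq.trans ?_ (Equiv.sum_comp σ _)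
    refine Finset.sum_congr rfl fun i _ => ?_
    rw [single_apply, single_apply, AlgHom.ofLinearMap_apply, permFactors_pure]
    congr 1
    ext1 j
    simp [Pi.mulSingle_apply, Equiv.symm_apply_eq]
  exact DFunLike.congr_fun key p

/-- The permutation of the tensor factors of `H^{⊗ n}` as an `H`-linear map. -/
def permFactorsH {n : ℕ} (σ : Equiv.Perm (Fin n)) : HTensor k n →ₗ[k[X]] HTensor k n where
  toFun := permFactors k σ
  map_add' := map_add _
  map_smul' p F := by simp [smul_def, permFactors_mul, permFactors_coprod]

variable (C : Type v) [AddCommGroup C] [Module k[X] C]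

/-- The map `σ ⊗_H id_C` on `H^{⊗ n} ⊗_H C`. -/
def permute {n : ℕ} (σ : Equiv.Perm (Fin n)) :
    HTensor k n ⊗[k[X]] C →ₗ[k[X]] HTensor k n ⊗[k[X]] C :=
  (permFactorsH k σ).rTensor C

end HTensor

/-! ### Conformal algebras -/

/-- A conformal algebra over `k`: a `k[D]`-module `C` (here `D` is the variable `X` of `k[X]`) with
`k`-bilinear products `a ₍n₎ b = nprod n a b`, `n ≥ 0`, that satisfy locality and
sesqui-linearity. -/
class ConformalAlgebra (k : Type u) (C : Type v) [Field k] [AddCommGroup C] [Module k C]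
    [Module k[X] C] [IsScalarTower k k[X] C] where
  nprod : ℕ → C →ₗ[k] C →ₗ[k] C
  locality : ∀ a b : C, ∃ N : ℕ, ∀ n ≥ N, nprod n a b = 0
  nprod_D_left : ∀ (n : ℕ) (a b : C),
    nprod n ((Polynomial.X : k[X]) • a) b = -((n : k) • nprod (n - 1) a b)
  nprod_D_right : ∀ (n : ℕ) (a b : C),
    nprod n a ((Polynomial.X : k[X]) • b)
      = (Polynomial.X : k[X]) • nprod n a b + (n : k) • nprod (n - 1) a b

section Conformal

variable (k : Type u) [Field k]
variable (C : Type v) [AddCommGroup C] [Module k C] [Module k[X] C] [IsScalarTower k k[X] C]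

open ConformalAlgebra (nprod locality nprod_D_left nprod_D_right)

variable {C} in
/-- The sum `∑_{s ≥ 0} g s (a ₍s₎ b)`, which is finite by locality. -/
def localSum [ConformalAlgebra k C] {P : Type*} [AddCommGroup P] [Module k P]
    (g : ℕ → C →ₗ[k] P) (a b : C) : P :=
  ∑ᶠ s : ℕ, g s (nprod (k := k) s a b)

section localSum

variable {k C}

variable (k C) in
/-- The action of `D` on `C` as a `k`-linear map. -/
def opD : C →ₗ[k] C := Algebra.lsmul k k C (Polynomial.X : k[X])

theorem opD_apply (a : C) : opD k C a = (Polynomial.X : k[X]) • a := rfl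

variable [ConformalAlgebra k C] {P : Type*} [AddCommGroup P] [Module k P]

theorem localSum_eq_sum (g : ℕ → C →ₗ[k] P) (a b : C) {N : ℕ}
    (hN : ∀ n ≥ N, nprod (k := k) n a b = 0) :
    localSum k g a b = ∑ s ∈ Finset.range N, g s (nprod (k := k) s a b) := by
  refine finsum_eq_sum_of_support_subset _ fun s hs => ?_
  by_contra h
  simp only [Finset.coe_range, Set.mem_Iio, not_lt] at h
  exact hs (by simp [hN s h])

theorem exists_local (a b a' b' : C) :
    ∃ N : ℕ, (∀ n ≥ N, nprod (k := k) n a b = 0) ∧ (∀ n ≥ N, nprod (k := k) n a' b' = 0) := by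
  obtain ⟨N, hN⟩ := locality (k := k) a b
  obtain ⟨N', hN'⟩ := locality (k := k) a' b'
  exact ⟨max N N', fun n hn => hN n (le_trans (le_max_left _ _) hn),
    fun n hn => hN' n (le_trans (le_max_right _ _) hn)⟩

variable (k) in
/-- `localSum` as a `k`-bilinear map. -/
def localSumₗ (g : ℕ → C →ₗ[k] P) : C →ₗ[k] C →ₗ[k] P :=
  LinearMap.mk₂ k (localSum k g)
    (fun a a' b => by
      obtain ⟨N, h, h'⟩ := exists_local (k := k) a b a' b
      rw [localSum_eq_sum g a b h, localSum_eq_sum g a' b h',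
        localSum_eq_sum g (a + a') b (N := N) (fun n hn => by simp [h n hn, h' n hn])]
      simp [Finset.sum_add_distrib])
    (fun c a b => by
      obtain ⟨N, h⟩ := locality (k := k) a b
      rw [localSum_eq_sum g a b h,
        localSum_eq_sum g (c • a) b (N := N) (fun n hn => by simp [h n hn])]
      simp [Finset.smul_sum])
    (fun a b b' => by
      obtain ⟨N, h, h'⟩ := exists_local (k := k) a b a b'
      rw [localSum_eq_sum g a b h, localSum_eq_sum g a b' h',
        localSum_eq_sum g a (b + b') (N := N) (fun n hn => by simp [h n hn, h' n hn])]
      simp [Finset.sum_add_distrib])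
    (fun c a b => by
      obtain ⟨N, h⟩ := locality (k := k) a b
      rw [localSum_eq_sum g a b h,
        localSum_eq_sum g a (c • b) (N := N) (fun n hn => by simp [h n hn])]
      simp [Finset.smul_sum])

theorem localSumₗ_apply (g : ℕ → C →ₗ[k] P) (a b : C) :
    localSumₗ k g a b = localSum k g a b := rfl

theorem localSum_congr {g g' : ℕ → C →ₗ[k] P} (h : ∀ s c, g s c = g' s c) (a b : C) :
    localSum k g a b = localSum k g' a b :=
  finsum_congr fun s => h s _

theorem localSum_map {Q : Type*} [AddCommGroup Q] [Module k Q] (φ : P →ₗ[k] Q)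
    (g : ℕ → C →ₗ[k] P) (a b : C) :
    φ (localSum k g a b) = localSum k (fun s => φ ∘ₗ g s) a b := by
  obtain ⟨N, h⟩ := locality (k := k) a b
  rw [localSum_eq_sum _ a b h, localSum_eq_sum _ a b h]
  simp

theorem localSum_D_left (g : ℕ → C →ₗ[k] P) (a b : C) :
    localSum k g ((Polynomial.X : k[X]) • a) b
      = localSum k (fun s => -(((s + 1 : ℕ) : k) • g (s + 1))) a b := by
  obtain ⟨N, h⟩ := locality (k := k) a b
  rw [localSum_eq_sum _ a b h, localSum_eq_sum g _ b (N := N + 1) (fun n hn => by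
    rw [nprod_D_left, h (n - 1) (by omega)]; simp), Finset.sum_range_succ']
  simp [nprod_D_left]

theorem localSum_D_right (g : ℕ → C →ₗ[k] P) (a b : C) :
    localSum k g a ((Polynomial.X : k[X]) • b)
      = localSum k (fun s => g s ∘ₗ opD k C + ((s + 1 : ℕ) : k) • g (s + 1)) a b := by
  obtain ⟨N, h⟩ := locality (k := k) a b
  rw [localSum_eq_sum _ a b (N := N + 1) (fun n hn => h n (by omega)),
    localSum_eq_sum g a _ (N := N + 1) (fun n hn => by
    rw [nprod_D_right, h n (by omega), h (n - 1) (by omega)]; simp)]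
  simp only [nprod_D_right, map_add, Finset.sum_add_distrib, LinearMap.add_apply,
    LinearMap.comp_apply, opD_apply]
  congr 1
  rw [Finset.sum_range_succ', Finset.sum_range_succ]
  simp [h N le_rfl]

end localSum

/-! ### The coefficient algebra -/

/-- The standard basis `t^n`, `n ∈ ℤ`, of the Laurent polynomials. -/
def laurentBasis : Module.Basis ℤ k (LaurentPolynomial k) := AddMonoidAlgebra.basis ℤ k

/-- The action of `D` on `k[t, t⁻¹]`: `t^n D = -n t^{n-1}`. -/
def laurentD : LaurentPolynomial k →ₗ[k] LaurentPolynomial k :=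
  (laurentBasis k).constr k fun n => (-(n : k)) • LaurentPolynomial.T (n - 1)

/-- The `H`-module `k[t, t⁻¹]`, where `D` acts by `t^n D = -n t^{n-1}`. -/
abbrev Laurent : Type u := Module.AEval' (laurentD k)

/-- The basis `t^n`, `n ∈ ℤ`, of `k[t, t⁻¹]`. -/
def tBasis : Module.Basis ℤ k (Laurent k) :=
  (laurentBasis k).map (Module.AEval'.of (laurentD k))

/-- The element `t^n` of the `H`-module `k[t, t⁻¹]`. -/
def tPow (n : ℤ) : Laurent k := Module.AEval'.of (laurentD k) (LaurentPolynomial.T n)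

theorem tBasis_apply (n : ℤ) : tBasis k n = tPow k n := rfl

theorem X_smul_tPow (n : ℤ) :
    (Polynomial.X : k[X]) • tPow k n = (-(n : k)) • tPow k (n - 1) := by
  have : laurentD k (LaurentPolynomial.T n) = (-(n : k)) • LaurentPolynomial.T (n - 1) := by
    rw [show (LaurentPolynomial.T n : LaurentPolynomial k) = laurentBasis k n from rfl,
      laurentD, Module.Basis.constr_basis]
  rw [tPow, Module.AEval'.X_smul_of, this, map_smul]
  rfl

/-- The space `Coeff C = k[t, t⁻¹] ⊗_H C`. -/
def Coeff : Type (max u v) := Laurent k ⊗[k[X]] C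

instance : AddCommGroup (Coeff k C) := inferInstanceAs (AddCommGroup (Laurent k ⊗[k[X]] C))

instance : Module k (Coeff k C) := inferInstanceAs (Module k (Laurent k ⊗[k[X]] C))

variable {C} in
/-- The element `a(n) = t^n ⊗_H a` of `Coeff C`, linear in `a`. -/
def coeff (n : ℤ) : C →ₗ[k] Coeff k C where
  toFun a := (tPow k n ⊗ₜ[k[X]] a : Laurent k ⊗[k[X]] C)
  map_add' := TensorProduct.tmul_add _
  map_smul' c a := by
    rw [← algebraMap_smul k[X] c a, TensorProduct.tmul_smul, algebraMap_smul]
    rfl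

theorem coeff_D (n : ℤ) (a : C) :
    coeff k n ((Polynomial.X : k[X]) • a) = (-(n : k)) • coeff k (n - 1) a := by
  change tPow k n ⊗ₜ[k[X]] ((Polynomial.X : k[X]) • a) = (-(n : k)) • (tPow k (n - 1) ⊗ₜ[k[X]] a)
  rw [← TensorProduct.smul_tmul, X_smul_tPow, TensorProduct.smul_tmul']

variable [ConformalAlgebra k C]

/-- The sum `∑_{s ≥ 0} (n choose s) (a ₍s₎ b)(n + m - s)`, bilinear in `a` and `b`. -/
def coeffMulBasis (n m : ℤ) : C →ₗ[k] C →ₗ[k] Coeff k C :=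
  localSumₗ k fun s => ((Ring.choose n s : ℤ) : k) • coeff k (n + m - s)

/-- The product of `Coeff C` as a function of `x, a, y, b`, where the factors are `x ⊗_H a` and
`y ⊗_H b`; for `x = t^n` and `y = t^m` it is given by `coeffMulBasis`. -/
def coeffMul₄ : Laurent k →ₗ[k] C →ₗ[k] Laurent k →ₗ[k] C →ₗ[k] Coeff k C :=
  (tBasis k).constr k fun n =>
    LinearMap.flip ((tBasis k).constr k fun m => coeffMulBasis k C n m)

theorem coeffMul₄_tPow (n m : ℤ) (a b : C) :
    coeffMul₄ k C (tPow k n) a (tPow k m) b = coeffMulBasis k C n m a b := by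
  rw [← tBasis_apply, ← tBasis_apply, coeffMul₄, Module.Basis.constr_basis, LinearMap.flip_apply,
    Module.Basis.constr_basis]

variable {k} in
theorem laurent_induction {p : Laurent k → Prop} (x : Laurent k) (h0 : p 0)
    (ht : ∀ n, p (tPow k n)) (ha : ∀ x y, p x → p y → p (x + y))
    (hs : ∀ (c : k) x, p x → p (c • x)) : p x := by
  have hx : x ∈ Submodule.span k (Set.range (tBasis k)) := by simp
  induction hx using Submodule.span_induction with
  | mem x h => obtain ⟨n, rfl⟩ := h; rw [tBasis_apply]; exact ht n
  | zero => exact h0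
  | add x y _ _ hx hy => exact ha x y hx hy
  | smul c x _ hx => exact hs c x hx

theorem succ_mul_choose_succ (n : ℤ) (s : ℕ) :
    ((s + 1 : ℕ) : ℤ) * Ring.choose n (s + 1) = (n - s) * Ring.choose n s := by
  have h₁ := Ring.descPochhammer_eq_factorial_smul_choose n s
  have h₂ := Ring.descPochhammer_eq_factorial_smul_choose n (s + 1)
  rw [← Polynomial.eval_eq_smeval, nsmul_eq_mul] at h₁ h₂
  rw [descPochhammer_succ_eval, h₁, Nat.factorial_succ] at h₂
  have h₀ : ((s.factorial : ℕ) : ℤ) ≠ 0 := by exact_mod_cast s.factorial_ne_zero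
  apply mul_left_cancel₀ h₀
  push_cast at h₂ ⊢
  linear_combination -h₂

theorem succ_mul_choose_succ' (n : ℤ) (s : ℕ) :
    ((s + 1 : ℕ) : ℤ) * Ring.choose n (s + 1) = n * Ring.choose (n - 1) s := by
  have h₁ := succ_mul_choose_succ (n - 1) s
  have h₂ := Ring.choose_succ_succ (n - 1) s
  rw [sub_add_cancel] at h₂
  rw [h₂]
  push_cast at h₁ ⊢
  linear_combination h₁

theorem coeffMul₄_D_left (x : Laurent k) (a : C) (y : Laurent k) (b : C) :
    coeffMul₄ k C ((Polynomial.X : k[X]) • x) a y b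
      = coeffMul₄ k C x ((Polynomial.X : k[X]) • a) y b := by
  induction x using laurent_induction with
  | h0 => simp
  | ha x y hx hy => simp only [smul_add, map_add, LinearMap.add_apply, hx, hy]
  | hs c x hx => rw [smul_comm]; simp only [map_smul, LinearMap.smul_apply, hx]
  | ht n =>
  induction y using laurent_induction with
  | h0 => simp
  | ha x y hx hy => simp only [map_add, LinearMap.add_apply, hx, hy]
  | hs c x hx => simp only [map_smul, LinearMap.smul_apply, hx]
  | ht m =>
  rw [X_smul_tPow, map_smul, LinearMap.smul_apply, LinearMap.smul_apply, LinearMap.smul_apply,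
    coeffMul₄_tPow, coeffMul₄_tPow, coeffMulBasis, coeffMulBasis, localSumₗ_apply,
    localSumₗ_apply, localSum_D_left, ← LinearMap.lsmul_apply, localSum_map]
  refine localSum_congr (fun s c => ?_) a b
  have h := congrArg (Int.cast (R := k)) (succ_mul_choose_succ' n s)
  push_cast at h
  have e : n - 1 + m - (s : ℤ) = n + m - ((s + 1 : ℕ) : ℤ) := by push_cast; ring
  simp only [LinearMap.comp_apply, LinearMap.smul_apply, LinearMap.lsmul_apply,
    LinearMap.neg_apply, smul_smul, e]
  rw [← neg_smul]
  congr 1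
  push_cast
  linear_combination h

theorem coeffMul₄_D_right (x : Laurent k) (a : C) (y : Laurent k) (b : C) :
    coeffMul₄ k C x a ((Polynomial.X : k[X]) • y) b
      = coeffMul₄ k C x a y ((Polynomial.X : k[X]) • b) := by
  induction x using laurent_induction with
  | h0 => simp
  | ha x y hx hy => simp only [map_add, LinearMap.add_apply, hx, hy]
  | hs c x hx => simp only [map_smul, LinearMap.smul_apply, hx]
  | ht n =>
  induction y using laurent_induction with
  | h0 => simp
  | ha x y hx hy => simp only [smul_add, map_add, LinearMap.add_apply, hx, hy]
  | hs c x hx => rw [smul_comm]; simp only [map_smul, LinearMap.smul_apply, hx]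
  | ht m =>
  rw [X_smul_tPow, map_smul, LinearMap.smul_apply,
    coeffMul₄_tPow, coeffMul₄_tPow, coeffMulBasis, coeffMulBasis, localSumₗ_apply,
    localSumₗ_apply, localSum_D_right, ← LinearMap.lsmul_apply, localSum_map]
  refine localSum_congr (fun s c => ?_) a b
  have h := congrArg (Int.cast (R := k)) (succ_mul_choose_succ n s)
  push_cast at h
  have e : n + (m - 1) - (s : ℤ) = n + m - s - 1 := by ring
  have e' : n + m - ((s + 1 : ℕ) : ℤ) = n + m - s - 1 := by push_cast; ring
  simp only [LinearMap.comp_apply, LinearMap.smul_apply, LinearMap.lsmul_apply, opD_apply,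
    LinearMap.add_apply, coeff_D, smul_smul, e, e']
  rw [← add_smul]
  congr 1
  push_cast
  linear_combination -h

/-- The multiplication of the coefficient algebra. -/
def coeffMul : Coeff k C →ₗ[k] Coeff k C →ₗ[k] Coeff k C :=
  liftX₂ (coeffMul₄ k C) (coeffMul₄_D_left k C) (coeffMul₄_D_right k C)

/-- The coefficient algebra, a nonassociative algebra over `k`. -/
instance : NonUnitalNonAssocRing (Coeff k C) where
  mul x y := coeffMul k C x y
  left_distrib x y z := map_add (coeffMul k C x) y z
  right_distrib x y z := by
    change coeffMul k C (x + y) z = coeffMul k C x z + coeffMul k C y z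
    simp
  zero_mul x := by
    change coeffMul k C 0 x = 0
    simp
  mul_zero x := map_zero (coeffMul k C x)

/-- The defining formula `a(n) b(m) = ∑_{s ≥ 0} (n choose s) (a ₍s₎ b)(n + m - s)`. -/
theorem coeff_mul_coeff (n m : ℤ) (a b : C) :
    coeff k n a * coeff k m b
      = ∑ᶠ s : ℕ, ((Ring.choose n s : ℤ) : k) • coeff k (n + m - s) (nprod (k := k) s a b) :=
  coeffMul₄_tPow k C n m a b

/-! ### The pseudoproduct -/


/-- The element `((-D)^s / s! ⊗ 1) ⊗_H c` of `(H ⊗ H) ⊗_H C`, linear in `c`. -/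
def pseudoTerm (s : ℕ) : C →ₗ[k] HTensor k 2 ⊗[k[X]] C where
  toFun c := pureT ![(s.factorial : k)⁻¹ • (-Polynomial.X) ^ s, 1] ⊗ₜ[k[X]] c
  map_add' := TensorProduct.tmul_add _
  map_smul' c a := by
    rw [← algebraMap_smul k[X] c a, TensorProduct.tmul_smul, algebraMap_smul]
    rfl

/-- The pseudoproduct `* : C × C → (H ⊗ H) ⊗_H C` of a conformal algebra. -/
def pseudo : C →ₗ[k] C →ₗ[k] HTensor k 2 ⊗[k[X]] C :=
  localSumₗ k (pseudoTerm k C)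

/-- The defining formula `a * b = ∑_{s ≥ 0} ((-D)^s / s! ⊗ 1) ⊗_H (a ₍s₎ b)`. -/
theorem pseudo_apply (a b : C) :
    pseudo k C a b
      = ∑ᶠ s : ℕ, pureT ![(s.factorial : k)⁻¹ • (-Polynomial.X) ^ s, 1] ⊗ₜ[k[X]]
          nprod (k := k) s a b := rfl

/-- Multiplication by an element of `H^{⊗ n}` as a `k`-linear map on `H^{⊗ n} ⊗_H C`. -/
def mulL {n : ℕ} (F : HTensor k n) : HTensor k n ⊗[k[X]] C →ₗ[k] HTensor k n ⊗[k[X]] C :=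
  Algebra.lsmul k k _ F

theorem mulL_apply {n : ℕ} (F : HTensor k n) (z : HTensor k n ⊗[k[X]] C) :
    mulL k C F z = F • z := rfl

theorem succ_mul_inv_factorial_succ [CharZero k] (s : ℕ) :
    ((s + 1 : ℕ) : k) * ((s + 1).factorial : k)⁻¹ = (s.factorial : k)⁻¹ := by
  have h₁ : ((s + 1 : ℕ) : k) ≠ 0 := by exact_mod_cast s.succ_ne_zero
  have h₂ : (s.factorial : k) ≠ 0 := by exact_mod_cast s.factorial_ne_zero
  rw [Nat.factorial_succ]
  push_cast at h₁ ⊢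
  field_simp

theorem vecCons_update (p p' q : k[X]) : Function.update ![p, q] 0 p' = ![p', q] := by
  ext1 i
  fin_cases i <;> rfl

theorem smul_pureT₂ (c : k) (p q : k[X]) : c • pureT ![p, q] = pureT ![c • p, q] := by
  have := (PiTensorProduct.tprod k (s := fun _ : Fin 2 => k[X])).map_update_smul ![p, q] 0 c p
  simp only [vecCons_update] at this
  exact this.symm

theorem pureT₂_add (p p' q : k[X]) :
    pureT ![p, q] + pureT ![p', q] = pureT ![p + p', q] := by
  have := (PiTensorProduct.tprod k (s := fun _ : Fin 2 => k[X])).map_update_add ![p, q] 0 p p'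
  simp only [vecCons_update] at this
  exact this.symm

theorem pseudoTerm_apply (s : ℕ) (c : C) : pseudoTerm k C s c
    = pureT ![(s.factorial : k)⁻¹ • (-Polynomial.X) ^ s, 1] ⊗ₜ[k[X]] c := rfl

theorem pseudo_D_left [CharZero k] (a b : C) :
    pseudo k C ((Polynomial.X : k[X]) • a) b
      = (pureT ![Polynomial.X, 1] : HTensor k 2) • pseudo k C a b := by
  rw [pseudo, localSumₗ_apply, localSumₗ_apply, localSum_D_left, ← mulL_apply, localSum_map]
  refine localSum_congr (fun s c => ?_) a b
  have hs := succ_mul_inv_factorial_succ k s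
  simp only [LinearMap.neg_apply, LinearMap.smul_apply, LinearMap.comp_apply, mulL_apply,
    pseudoTerm_apply, TensorProduct.smul_tmul', smul_eq_mul, pure_mul]
  rw [← TensorProduct.neg_tmul]
  congr 1
  rw [smul_pureT₂, smul_smul, hs, ← neg_one_smul k, smul_pureT₂]
  congr 1
  ext1 i
  fin_cases i
  · simp [pow_succ, mul_comm]
  · simp

theorem pseudo_D_right [CharZero k] (a b : C) :
    pseudo k C a ((Polynomial.X : k[X]) • b)
      = (pureT ![1, Polynomial.X] : HTensor k 2) • pseudo k C a b := by
  rw [pseudo, localSumₗ_apply, localSumₗ_apply, localSum_D_right, ← mulL_apply, localSum_map]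
  refine localSum_congr (fun s c => ?_) a b
  have hs := succ_mul_inv_factorial_succ k s
  simp only [LinearMap.add_apply, LinearMap.smul_apply, LinearMap.comp_apply, mulL_apply,
    pseudoTerm_apply, TensorProduct.smul_tmul', smul_eq_mul, pure_mul, opD_apply]
  rw [← TensorProduct.smul_tmul, ← TensorProduct.add_tmul]
  congr 1
  rw [smul_pureT₂, smul_smul, hs, smul_def, coprod_X, Fin.sum_univ_two, add_mul, single_apply,
    single_apply, pure_mul, pure_mul, add_right_comm]
  convert zero_add _ using 2
  · rw [show (Pi.mulSingle (0 : Fin 2) (Polynomial.X : k[X]) * ![(s.factorial : k)⁻¹ • (-Polynomial.X) ^ s, 1] :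
        Fin 2 → k[X]) = ![Polynomial.X * ((s.factorial : k)⁻¹ • (-Polynomial.X) ^ s), 1] by
      ext1 i
      fin_cases i <;> simp, pureT₂_add, ← zero_smul k (pureT ![0, 1]), smul_pureT₂]
    congr 2
    simp [pow_succ, mul_comm]
  · congr 1
    ext1 i
    fin_cases i <;> simp

/-- The map `Δ^{(n)} ⊗ Δ^{(m)} ⊗_H id_C : (H ⊗ H) ⊗_H C → H^{⊗ (n + m)} ⊗_H C`. -/
def splitMap (n m : ℕ) : HTensor k 2 ⊗[k[X]] C →ₗ[k] HTensor k (n + m) ⊗[k[X]] C :=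
  ((splitCoprodH k n m).rTensor C).restrictScalars k

theorem splitMap_smul (n m : ℕ) (F : HTensor k 2) (z : HTensor k 2 ⊗[k[X]] C) :
    splitMap k C n m (F • z) = splitCoprod k n m F • splitMap k C n m z := by
  induction z using TensorProduct.induction_on with
  | zero => simp
  | add x y hx hy => simp only [smul_add, map_add, hx, hy]
  | tmul G c =>
    change (splitCoprodH k n m (F * G)) ⊗ₜ[k[X]] c
      = (splitCoprod k n m F * splitCoprodH k n m G) ⊗ₜ[k[X]] c
    congr 1
    exact map_mul (splitCoprod k n m) F G

/-- The expanded pseudoproduct of `F ⊗_H a` and `G ⊗_H b`, that is,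
`(F ⊗ G ⊗_H 1) (Δ^{(n)} ⊗ Δ^{(m)} ⊗_H id_C) (a * b)`, as a function of `F, a, G, b`. -/
def expanded₄ (n m : ℕ) :
    HTensor k n →ₗ[k] C →ₗ[k] HTensor k m →ₗ[k] C →ₗ[k] HTensor k (n + m) ⊗[k[X]] C :=
  LinearMap.mk₂ k
    (fun F a => LinearMap.mk₂ k (fun G b => juxt k F G • splitMap k C n m (pseudo k C a b))
      (fun _ _ _ => by simp [add_smul])
      (fun _ _ _ => by simp)
      (fun _ _ _ => by simp)
      (fun c _ _ => by simp [smul_comm _ c]))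
    (fun _ _ _ => by ext; simp [add_smul])
    (fun _ _ _ => by ext; simp)
    (fun _ _ _ => by ext; simp)
    (fun c _ _ => by ext; simp [smul_comm _ c])

theorem expanded₄_apply (n m : ℕ) (F : HTensor k n) (a : C) (G : HTensor k m) (b : C) :
    expanded₄ k C n m F a G b = juxt k F G • splitMap k C n m (pseudo k C a b) := rfl

/-- The expanded pseudoproduct
`* : (H^{⊗ n} ⊗_H C) × (H^{⊗ m} ⊗_H C) → H^{⊗ (n + m)} ⊗_H C`. -/
def expanded [CharZero k] (n m : ℕ) :
    HTensor k n ⊗[k[X]] C →ₗ[k] HTensor k m ⊗[k[X]] C →ₗ[k] HTensor k (n + m) ⊗[k[X]] C :=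
  liftX₂ (expanded₄ k C n m)
    (fun F a G b => by
      rw [expanded₄_apply, expanded₄_apply, pseudo_D_left, splitMap_smul, splitCoprod_pure,
        smul_smul, juxt_mul, smul_def]
      simp [mul_comm])
    (fun F a G b => by
      rw [expanded₄_apply, expanded₄_apply, pseudo_D_right, splitMap_smul, splitCoprod_pure,
        smul_smul, juxt_mul, smul_def]
      simp [mul_comm])

/-- The defining formula of the expanded pseudoproduct. -/
theorem expanded_tmul [CharZero k] (n m : ℕ) (F : HTensor k n) (a : C) (G : HTensor k m) (b : C) :
    expanded k C n m (F ⊗ₜ a) (G ⊗ₜ b) = juxt k F G • splitMap k C n m (pseudo k C a b) := rfl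

variable {C}

/-- The element `a` of `C` as the element `1 ⊗_H a` of `H ⊗_H C`. -/
def incl (a : C) : HTensor k 1 ⊗[k[X]] C := 1 ⊗ₜ[k[X]] a

/-- The element `(a * b) * c` of `H^{⊗ 3} ⊗_H C`. -/
def pseudoLeft [CharZero k] (a b c : C) : HTensor k 3 ⊗[k[X]] C :=
  expanded k C 2 1 (pseudo k C a b) (incl k c)

/-- The element `a * (b * c)` of `H^{⊗ 3} ⊗_H C`. -/
def pseudoRight [CharZero k] (a b c : C) : HTensor k 3 ⊗[k[X]] C :=
  expanded k C 1 2 (incl k a) (pseudo k C b c)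

end Conformal

/-! ### Alternative laws -/

/-- Left alternative algebras: `a² b = a (a b)`. -/
def IsLeftAlternative (A : Type*) [Mul A] : Prop := ∀ a b : A, (a * a) * b = a * (a * b)

/-- Right alternative algebras: `a b² = (a b) b`. -/
def IsRightAlternative (A : Type*) [Mul A] : Prop := ∀ a b : A, a * (b * b) = (a * b) * b

end

end ConformalAlg

namespace ConformalAlg

noncomputable section

universe u v

/-! ### The action of `H^{⊗ n}` on Laurent polynomials -/

section LaurentAction

variable (k : Type u) [Field k]

/-! Both identities live in `H^{⊗ 3} ⊗_H C`, and both alternative laws live in `Coeff C`; a family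
of evaluation maps connects the two. Given Laurent polynomials `x 0, …, x (n - 1)`, let each tensor
factor of `H^{⊗ n}` act on its own `x i` and multiply the results. Since `D = -d/dt` is a
derivation, this is `H`-linear (`act`), and tensoring with `C` gives `evalAt`.

Because `(-D)^s / s!` sends `t^n` to `(n choose s) t^{n-s}`, the evaluation of `a * b` at `x, y` is
the product of `x ⊗ a` and `y ⊗ b` (`coeffTmul_mul_coeffTmul`). By `H`-linearity the same holds for
the expanded pseudoproduct (`evalAt_expanded`), and a permutation of the tensor factors only
permutes the arguments (`evalAt_permute`). So evaluating the pseudoalgebra identities yields the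
linearized alternative laws on pure tensors, and these are equivalent to the alternative laws since
2 is invertible.

To return from `Coeff C`, the evaluations must be jointly injective (`eq_zero_of_evalAt_eq_zero`).
An element is a sum of `((-D)^i / i! ⊗ (-D)^j / j! ⊗ 1) ⊗_H c_ij`. Its value at `t^i, t^j, t^{-1}`
is triangular in the `c_ij` with diagonal term `c_ij(-1)`, and `c ↦ c(-1)` is injective. -/

theorem laurentD_T (n : ℤ) :
    laurentD k (LaurentPolynomial.T n) = (-(n : k)) • LaurentPolynomial.T (n - 1) := by
  rw [show (LaurentPolynomial.T n : LaurentPolynomial k) = laurentBasis k n from rfl,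
    laurentD, Module.Basis.constr_basis]

/-- By bilinearity this reduces to monomials, where it is `-(n + m) = -m - n`. All `H`-linearity of
evaluation rests on it. -/
theorem laurentD_mul (f g : LaurentPolynomial k) :
    laurentD k (f * g) = f * laurentD k g + g * laurentD k f := by
  induction f using LaurentPolynomial.induction_on' with
  | add f f' h h' => rw [add_mul, map_add, map_add, h, h']; ring
  | C_mul_T n a =>
  induction g using LaurentPolynomial.induction_on' with
  | add g g' h h' => rw [mul_add, map_add, map_add, h, h']; ring
  | C_mul_T m b =>
  rw [← LaurentPolynomial.smul_eq_C_mul, ← LaurentPolynomial.smul_eq_C_mul,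
    smul_mul_smul_comm, ← LaurentPolynomial.T_add, map_smul, map_smul, map_smul, laurentD_T,
    laurentD_T, laurentD_T, smul_mul_smul_comm, smul_mul_smul_comm, mul_smul_comm, mul_smul_comm,
    ← LaurentPolynomial.T_add, ← LaurentPolynomial.T_add, show n + (m - 1) = n + m - 1 by ring,
    show m + (n - 1) = n + m - 1 by ring, smul_smul, smul_smul, smul_smul, ← add_smul]
  congr 1
  push_cast
  ring

/-- The operator `t^n ↦ -n t^{n-1}` as a derivation of `k[t, t⁻¹]`. -/
def laurentDer : Derivation k (LaurentPolynomial k) (LaurentPolynomial k) :=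
  Derivation.mk' (laurentD k) (laurentD_mul k)

/-- The product of two elements of the `H`-module `k[t, t⁻¹]`. -/
def tMul : Laurent k →ₗ[k] Laurent k →ₗ[k] Laurent k :=
  ((LinearMap.mul k (LaurentPolynomial k)).compl₁₂
    (Module.AEval'.of (laurentD k)).symm.toLinearMap
    (Module.AEval'.of (laurentD k)).symm.toLinearMap).compr₂
    (Module.AEval'.of (laurentD k)).toLinearMap

theorem tMul_tPow (n m : ℤ) : tMul k (tPow k n) (tPow k m) = tPow k (n + m) := by
  change Module.AEval'.of (laurentD k) (LaurentPolynomial.T n * LaurentPolynomial.T m) = _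
  rw [← LaurentPolynomial.T_add]
  rfl

theorem of_symm_X_smul (x : Laurent k) :
    (Module.AEval'.of (laurentD k)).symm ((Polynomial.X : k[X]) • x)
      = laurentDer k ((Module.AEval'.of (laurentD k)).symm x) := by
  obtain ⟨f, rfl⟩ := (Module.AEval'.of (laurentD k)).surjective x
  rw [Module.AEval'.X_smul_of, LinearEquiv.symm_apply_apply, LinearEquiv.symm_apply_apply]
  rfl

variable {k}

/-- The linear map `H^{⊗ n} → k[t, t⁻¹]` that sends `h 0 ⊗ ⋯ ⊗ h (n - 1)` to the product of the
`h i • x i`. -/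
def actₗ {n : ℕ} (x : Fin n → Laurent k) : HTensor k n →ₗ[k] Laurent k :=
  (Module.AEval'.of (laurentD k)).toLinearMap ∘ₗ
    PiTensorProduct.lift
      ((MultilinearMap.mkPiAlgebra k (Fin n) (LaurentPolynomial k)).compLinearMap fun i =>
        (Module.AEval'.of (laurentD k)).symm.toLinearMap ∘ₗ
          (LinearMap.toSpanSingleton k[X] (Laurent k) (x i)).restrictScalars k)

theorem actₗ_pure {n : ℕ} (x : Fin n → Laurent k) (h : Fin n → k[X]) :
    actₗ x (pureT h) = Module.AEval'.of (laurentD k)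
      (∏ i, (Module.AEval'.of (laurentD k)).symm (h i • x i)) := by
  exact congrArg (Module.AEval'.of (laurentD k)) (PiTensorProduct.lift.tprod h)

/-- The Leibniz rule, with each summand kept as a single product over `s` so that it matches `D`
placed in the `i`-th tensor factor. -/
theorem derivation_prod {R A ι : Type*} [CommSemiring R] [CommSemiring A] [Algebra R A]
    [DecidableEq ι] (d : Derivation R A A) (s : Finset ι) (f : ι → A) :
    d (∏ i ∈ s, f i) = ∑ i ∈ s, ∏ j ∈ s, if j = i then d (f j) else f j := by
  induction s using Finset.induction_on with
  | empty => simp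
  | insert a s ha ih =>
    rw [Finset.prod_insert ha, Derivation.leibniz, ih, Finset.sum_insert ha,
      Finset.prod_insert ha, if_pos rfl, smul_eq_mul, smul_eq_mul, add_comm, mul_comm,
      Finset.mul_sum]
    congr 1
    · congr 1
      refine Finset.prod_congr rfl fun j hj => (if_neg ?_).symm
      rintro rfl
      exact ha hj
    · refine Finset.sum_congr rfl fun i hi => ?_
      rw [Finset.prod_insert ha, if_neg]
      rintro rfl
      exact ha hi

/-- The coproduct of `D` is the sum of `D` over all places, and the Leibniz rule gives the same sum
term by term. -/
theorem actₗ_X_smul {n : ℕ} (x : Fin n → Laurent k) (F : HTensor k n) :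
    actₗ x ((Polynomial.X : k[X]) • F) = (Polynomial.X : k[X]) • actₗ x F := by
  induction F using HTensor.induction with
  | ha F G hF hG => simp only [smul_add, map_add, hF, hG]
  | hp c h =>
    rw [smul_comm, map_smul (actₗ x) c, map_smul (actₗ x) c, smul_comm Polynomial.X c]
    congr 1
    apply (Module.AEval'.of (laurentD k)).symm.injective
    rw [of_symm_X_smul, actₗ_pure, LinearEquiv.symm_apply_apply, derivation_prod, smul_def,
      coprod_X, Finset.sum_mul, map_sum, map_sum]
    refine Finset.sum_congr rfl fun i _ => ?_
    rw [single_apply, pure_mul, actₗ_pure, LinearEquiv.symm_apply_apply]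
    refine Finset.prod_congr rfl fun j _ => ?_
    split_ifs with hj
    · subst hj
      rw [Pi.mul_apply, Pi.mulSingle_eq_same, mul_smul, of_symm_X_smul]
    · rw [Pi.mul_apply, Pi.mulSingle_eq_of_ne hj, one_mul]

/-- The map `actₗ x` is linear over `H`, because `D` acts on `k[t, t⁻¹]` as a derivation. -/
def act {n : ℕ} (x : Fin n → Laurent k) : HTensor k n →ₗ[k[X]] Laurent k where
  toFun := actₗ x
  map_add' := map_add _
  map_smul' p F := by
    simp only [RingHom.id_apply]
    induction p using Polynomial.induction_on generalizing F with
    | C a =>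
      have h₁ : (Polynomial.C a : k[X]) • F = a • F := algebraMap_smul k[X] a F
      have h₂ : (Polynomial.C a : k[X]) • actₗ x F = a • actₗ x F := algebraMap_smul k[X] a _
      rw [h₁, h₂, map_smul]
    | add p q hp hq => simp only [add_smul, map_add, hp, hq]
    | monomial i a ih => rw [pow_succ, ← mul_assoc, mul_smul, ih, actₗ_X_smul, ← mul_smul]

theorem act_pure {n : ℕ} (x : Fin n → Laurent k) (h : Fin n → k[X]) :
    act x (pureT h) = Module.AEval'.of (laurentD k)
      (∏ i, (Module.AEval'.of (laurentD k)).symm (h i • x i)) :=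
  actₗ_pure x h

theorem act_smul {n : ℕ} (x : Fin n → Laurent k) (c : k) (F : HTensor k n) :
    act x (c • F) = c • act x F :=
  map_smul (actₗ x) c F

theorem act_pure₂ (x y : Laurent k) (p q : k[X]) :
    act ![x, y] (pureT ![p, q]) = tMul k (p • x) (q • y) := by
  rw [act_pure, Fin.prod_univ_two]
  rfl

theorem act_pure₃ (x y z : Laurent k) (p q r : k[X]) :
    act ![x, y, z] (pureT ![p, q, r]) = tMul k (tMul k (p • x) (q • y)) (r • z) := by
  rw [act_pure, Fin.prod_univ_three]
  rfl

theorem act_one₁ (x : Laurent k) : act ![x] (1 : HTensor k 1) = x := by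
  rw [← pure_one, act_pure, Fin.prod_univ_one]
  simp

theorem act_juxt {n m : ℕ} (x : Fin n → Laurent k) (y : Fin m → Laurent k)
    (F : HTensor k n) (G : HTensor k m) :
    act (Fin.append x y) (juxt k F G) = tMul k (act x F) (act y G) := by
  induction F using HTensor.induction with
  | ha F₁ F₂ h₁ h₂ => simp only [map_add, LinearMap.add_apply, h₁, h₂]
  | hp a f =>
  induction G using HTensor.induction with
  | ha F₁ F₂ h₁ h₂ => simp only [map_add, h₁, h₂]
  | hp b g =>
  simp only [map_smul, LinearMap.smul_apply, act_smul]
  congr 2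
  rw [juxt_pure, act_pure, act_pure, act_pure, Fin.prod_univ_add]
  simp only [Fin.append_left, Fin.append_right]
  rfl

/-- The factor from place `i` lands at place `σ i` and meets `x (σ i)` there; commutativity of `k[t,
t⁻¹]` allows the product to be reindexed. -/
theorem act_permFactorsH {n : ℕ} (σ : Equiv.Perm (Fin n)) (x : Fin n → Laurent k)
    (F : HTensor k n) : act x (permFactorsH k σ F) = act (x ∘ σ) F := by
  change act x (permFactors k σ F) = _
  induction F using HTensor.induction with
  | ha F₁ F₂ h₁ h₂ => simp only [map_add, h₁, h₂]
  | hp a f =>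
  rw [map_smul, act_smul, act_smul, permFactors_pure, act_pure, act_pure, ← Equiv.prod_comp σ]
  simp

/-- Multiplication by `Δ^{(n)}(p) ⊗ Δ^{(m)}(q)` in `H^{⊗ (n + m)}` is turned into the actions of
`p` and `q` on the two factors. -/
theorem act_juxt_mul_splitCoprod {n m : ℕ} (x : Fin n → Laurent k) (y : Fin m → Laurent k)
    (F : HTensor k n) (G : HTensor k m) (K : HTensor k 2) :
    act (Fin.append x y) (juxt k F G * splitCoprod k n m K)
      = act ![act x F, act y G] K := by
  induction K using HTensor.induction with
  | ha F₁ F₂ h₁ h₂ => simp only [map_add, mul_add, h₁, h₂]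
  | hp a f =>
  -- Multiplying `F` by the coproduct of a polynomial is its module action on `F`, so `H`-linearity
  -- of `act` moves it onto the Laurent side.
  rw [map_smul, mul_smul_comm, act_smul, act_smul, splitCoprod_pure, juxt_mul, act_juxt,
    mul_comm F, mul_comm G, ← smul_def, ← smul_def, (act x).map_smul, (act y).map_smul,
    ← act_pure₂]
  congr 3
  ext1 i
  fin_cases i <;> rfl

/-- The divided power `(-D)^s / s!`. -/
def negDivPow (k : Type u) [Field k] (s : ℕ) : k[X] :=
  (s.factorial : k)⁻¹ • (-Polynomial.X) ^ s

/-- The source of the binomial coefficients in the product of `Coeff C`. Induction on `s` uses `(s +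
1) (n choose s + 1) = (n - s) (n choose s)`, which also holds for negative `n`. -/
theorem negDivPow_smul_tPow [CharZero k] (s : ℕ) (n : ℤ) :
    negDivPow k s • tPow k n = ((Ring.choose n s : ℤ) : k) • tPow k (n - s) := by
  induction s with
  | zero => simp [negDivPow]
  | succ s ih =>
    have hs : ((s + 1 : ℕ) : k) ≠ 0 := by exact_mod_cast s.succ_ne_zero
    have e : negDivPow k (s + 1)
        = (((s + 1 : ℕ) : k)⁻¹ • (-Polynomial.X)) * negDivPow k s := by
      rw [negDivPow, negDivPow, smul_mul_smul_comm, Nat.factorial_succ, Nat.cast_mul,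
        mul_inv, pow_succ']
    have h := congrArg (Int.cast (R := k)) (succ_mul_choose_succ n s)
    push_cast at h hs
    rw [e, mul_smul, ih, smul_comm _ (((Ring.choose n s : ℤ) : k)), smul_assoc,
      ← neg_one_smul k (Polynomial.X : k[X]), smul_assoc, X_smul_tPow, smul_smul, smul_smul,
      smul_smul,
      show n - (s : ℤ) - 1 = n - ((s + 1 : ℕ) : ℤ) by push_cast; ring]
    congr 1
    push_cast
    field_simp
    linear_combination -h

end LaurentAction

/-! ### Evaluation of elements of `H^{⊗ n} ⊗_H C` in the coefficient algebra -/

section Evaluation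

variable {k : Type u} [Field k]
variable {C : Type v} [AddCommGroup C] [Module k C] [Module k[X] C] [IsScalarTower k k[X] C]

variable (C) in
/-- The map `H^{⊗ n} ⊗_H C → Coeff C`, `F ⊗_H c ↦ (F · (x 0 ⊗ ⋯ ⊗ x (n - 1))) ⊗_H c`. -/
def evalAt {n : ℕ} (x : Fin n → Laurent k) : HTensor k n ⊗[k[X]] C →ₗ[k] Coeff k C :=
  ((act x).rTensor C).restrictScalars k

/-- The element `x ⊗_H c` of `Coeff C`. -/
def coeffTmul (x : Laurent k) (c : C) : Coeff k C := (x ⊗ₜ[k[X]] c : Laurent k ⊗[k[X]] C)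

theorem coeffTmul_tPow (n : ℤ) (c : C) : coeffTmul (tPow k n) c = coeff k n c := rfl

theorem coeffTmul_smul (a : k) (x : Laurent k) (c : C) :
    coeffTmul (a • x) c = a • coeffTmul x c := rfl

theorem coeffTmul_zero (c : C) : coeffTmul (0 : Laurent k) c = 0 :=
  TensorProduct.zero_tmul _ _

theorem coeffTmul_add (x y : Laurent k) (c : C) :
    coeffTmul (x + y) c = coeffTmul x c + coeffTmul y c :=
  TensorProduct.add_tmul _ _ _

theorem Coeff.induction {p : Coeff k C → Prop} (x : Coeff k C) (h0 : p 0)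
    (ht : ∀ x c, p (coeffTmul x c)) (ha : ∀ x y, p x → p y → p (x + y)) : p x :=
  TensorProduct.induction_on x h0 ht ha

theorem evalAt_tmul {n : ℕ} (x : Fin n → Laurent k) (F : HTensor k n) (c : C) :
    evalAt C x (F ⊗ₜ c) = coeffTmul (act x F) c := rfl

theorem evalAt_permute {n : ℕ} (σ : Equiv.Perm (Fin n)) (x : Fin n → Laurent k)
    (z : HTensor k n ⊗[k[X]] C) : evalAt C x (permute k C σ z) = evalAt C (x ∘ σ) z := by
  induction z using TensorProduct.induction_on with
  | zero => simp
  | add z w hz hw => simp only [map_add, hz, hw]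
  | tmul F c =>
    change coeffTmul (act x (permFactorsH k σ F)) c = coeffTmul (act (x ∘ σ) F) c
    rw [act_permFactorsH]

variable [ConformalAlgebra k C]

theorem evalAt_incl (x : Laurent k) (c : C) : evalAt C ![x] (incl k c) = coeffTmul x c := by
  rw [incl, evalAt_tmul, act_one₁]

theorem evalAt_juxt_smul_splitMap {n m : ℕ} (x : Fin n → Laurent k) (y : Fin m → Laurent k)
    (F : HTensor k n) (G : HTensor k m) (z : HTensor k 2 ⊗[k[X]] C) :
    evalAt C (Fin.append x y) (juxt k F G • splitMap k C n m z)
      = evalAt C ![act x F, act y G] z := by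
  induction z using TensorProduct.induction_on with
  | zero => simp
  | add z w hz hw => simp only [map_add, smul_add, hz, hw]
  | tmul K c =>
    change coeffTmul (act (Fin.append x y) (juxt k F G * splitCoprod k n m K)) c
      = coeffTmul (act ![act x F, act y G] K) c
    rw [act_juxt_mul_splitCoprod]

/-- The product of the coefficient algebra is the evaluation of the pseudoproduct. -/
theorem coeffTmul_mul_coeffTmul [CharZero k] (x y : Laurent k) (a b : C) :
    coeffTmul x a * coeffTmul y b = evalAt C ![x, y] (pseudo k C a b) := by
  change coeffMul₄ k C x a y b = _
  -- The bound depends only on `a` and `b`, so one finite sum, bilinear in the Laurent arguments,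
  -- serves all of them and the check reduces to `t^n, t^m`.
  obtain ⟨N, hN⟩ := ConformalAlgebra.locality (k := k) a b
  have key : ∀ z w : Laurent k, evalAt C ![z, w] (pseudo k C a b)
      = ∑ s ∈ Finset.range N, coeffTmul (tMul k (negDivPow k s • z) w)
          (ConformalAlgebra.nprod (k := k) s a b) := by
    intro z w
    rw [pseudo, localSumₗ_apply, localSum_eq_sum _ a b hN, map_sum]
    refine Finset.sum_congr rfl fun s _ => ?_
    rw [pseudoTerm_apply, evalAt_tmul, act_pure₂, one_smul]
    rfl
  rw [key]
  induction x using laurent_induction with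
  | h0 => simp [coeffTmul_zero]
  | ha x y hx hy =>
    simp only [map_add, LinearMap.add_apply, hx, hy, smul_add, coeffTmul_add, Finset.sum_add_distrib]
  | hs c x hx =>
    simp only [map_smul, LinearMap.smul_apply, hx, smul_comm _ c, coeffTmul_smul,
      Finset.smul_sum]
  | ht n =>
  induction y using laurent_induction with
  | h0 => simp [coeffTmul_zero]
  | ha x y hx hy =>
    simp only [map_add, LinearMap.add_apply, hx, hy, coeffTmul_add, Finset.sum_add_distrib]
  | hs c x hx =>
    simp only [map_smul, LinearMap.smul_apply, hx, coeffTmul_smul, Finset.smul_sum]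
  | ht m =>
  rw [coeffMul₄_tPow, coeffMulBasis, localSumₗ_apply, localSum_eq_sum _ a b hN]
  refine Finset.sum_congr rfl fun s _ => ?_
  rw [negDivPow_smul_tPow, (tMul k).map_smul, LinearMap.smul_apply, LinearMap.smul_apply,
    tMul_tPow, coeffTmul_smul,
    coeffTmul_tPow, show n + m - (s : ℤ) = n - s + m by ring]

/-- Evaluation turns the expanded pseudoproduct into the product of the coefficient algebra. -/
theorem evalAt_expanded [CharZero k] {n m : ℕ} (x : Fin n → Laurent k) (y : Fin m → Laurent k)
    (z : HTensor k n ⊗[k[X]] C) (w : HTensor k m ⊗[k[X]] C) :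
    evalAt C (Fin.append x y) (expanded k C n m z w) = evalAt C x z * evalAt C y w := by
  induction z using TensorProduct.induction_on with
  | zero => simp
  | add z w hz hw => simp only [map_add, LinearMap.add_apply, add_mul, hz, hw]
  | tmul F a =>
  induction w using TensorProduct.induction_on with
  | zero => simp
  | add z w hz hw => simp only [map_add, mul_add, hz, hw]
  | tmul G b =>
  rw [expanded_tmul, evalAt_juxt_smul_splitMap, evalAt_tmul, evalAt_tmul,
    coeffTmul_mul_coeffTmul]

theorem evalAt_pseudoLeft [CharZero k] (x y z : Laurent k) (a b c : C) :
    evalAt C ![x, y, z] (pseudoLeft k a b c)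
      = coeffTmul x a * coeffTmul y b * coeffTmul z c := by
  rw [coeffTmul_mul_coeffTmul, ← evalAt_incl z c, ← evalAt_expanded]
  congr 2
  ext1 i
  fin_cases i <;> rfl

theorem evalAt_pseudoRight [CharZero k] (x y z : Laurent k) (a b c : C) :
    evalAt C ![x, y, z] (pseudoRight k a b c)
      = coeffTmul x a * (coeffTmul y b * coeffTmul z c) := by
  rw [coeffTmul_mul_coeffTmul, ← evalAt_incl x a, ← evalAt_expanded]
  congr 2
  ext1 i
  fin_cases i <;> rfl

end Evaluation

/-! ### Joint injectivity of the evaluations -/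

section Injectivity

variable (k : Type u) [Field k]
variable (C : Type v) [AddCommGroup C] [Module k C] [Module k[X] C] [IsScalarTower k k[X] C]

/-- The map on `C` given by the coefficient at `t⁻¹`, that is, by `t^{-m-1} ⊗_H c ↦ D^m c / m!`. -/
def residueBasis : ℤ → C →ₗ[k] C
  | Int.ofNat _ => 0
  | Int.negSucc m => (m.factorial : k)⁻¹ • opD k C ^ m

/-- The map `Coeff C → C` with kernel spanned by the `c(n)`, `n ≥ 0`, and with `c(-1) ↦ c`. -/
def residue [CharZero k] : Coeff k C →ₗ[k] C :=
  liftX ((tBasis k).constr k (residueBasis k C)) (fun x c => by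
    induction x using laurent_induction with
    | h0 => simp
    | ha x y hx hy => simp only [smul_add, map_add, LinearMap.add_apply, hx, hy]
    | hs a x hx => rw [smul_comm]; simp only [map_smul, LinearMap.smul_apply, hx]
    | ht n =>
    rw [X_smul_tPow, map_smul, ← tBasis_apply, ← tBasis_apply, Module.Basis.constr_basis,
      Module.Basis.constr_basis]
    -- At `n = 0` the factor `-n` vanishes, which makes up for the jump from zero to a nonzero value
    -- between `t^0` and `t^{-1}`. For negative `n` the balance is `(m + 1) / (m + 1)! = 1 / m!`.
    match n with
    | Int.ofNat 0 => simp [residueBasis]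
    | Int.ofNat (n + 1) =>
      rw [show Int.ofNat (n + 1) - 1 = Int.ofNat n by simp]
      simp [residueBasis]
    | Int.negSucc m =>
      have h := succ_mul_inv_factorial_succ k m
      rw [show Int.negSucc m - 1 = Int.negSucc (m + 1) from rfl]
      simp only [residueBasis, LinearMap.smul_apply, smul_smul, ← opD_apply (k := k), pow_succ,
        Module.End.mul_apply]
      congr 1
      rw [← h, Int.negSucc_eq]
      push_cast
      ring)

variable {k C}

theorem coeff_neg_one_injective [CharZero k] :
    Function.Injective (coeff k (-1) : C → Coeff k C) := by
  have h : Function.LeftInverse (residue k C) (coeff k (-1)) := by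
    intro c
    change (tBasis k).constr k (residueBasis k C) (tBasis k (-1)) c = c
    rw [Module.Basis.constr_basis, show (-1 : ℤ) = Int.negSucc 0 from rfl]
    simp [residueBasis]
  exact h.injective

theorem pureT_three (p q r : k[X]) :
    pureT ![p, q, r] = single k (0 : Fin 3) p * single k 1 q * single k 2 r := by
  rw [single_apply, single_apply, single_apply, pure_mul, pure_mul]
  congr 1
  ext1 i
  fin_cases i <;> simp

theorem X_mul_negDivPow [CharZero k] (i : ℕ) :
    Polynomial.X * negDivPow k i = (-((i + 1 : ℕ) : k)) • negDivPow k (i + 1) := by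
  rw [negDivPow, negDivPow, smul_smul, neg_mul, succ_mul_inv_factorial_succ, mul_smul_comm,
    pow_succ', neg_mul, smul_neg, neg_smul, neg_neg]

/-- The elements `((-D)^i / i! ⊗ (-D)^j / j! ⊗ 1) ⊗_H c` span `H^{⊗ 3} ⊗_H C`. -/
theorem exists_eq_sum_negDivPow [CharZero k] (z : HTensor k 3 ⊗[k[X]] C) :
    ∃ f : ℕ × ℕ →₀ C, z = f.sum fun ij c =>
      pureT ![negDivPow k ij.1, negDivPow k ij.2, 1] ⊗ₜ[k[X]] c := by
  let L : (ℕ × ℕ →₀ C) →ₗ[k] HTensor k 3 ⊗[k[X]] C := Finsupp.lsum k fun ij =>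
    (TensorProduct.mk k[X] (HTensor k 3) C
      (pureT ![negDivPow k ij.1, negDivPow k ij.2, 1])).restrictScalars k
  suffices h : z ∈ LinearMap.range L by
    obtain ⟨f, rfl⟩ := h
    exact ⟨f, rfl⟩
  have hL : ∀ i j c, (single k 0 (negDivPow k i) * single k 1 (negDivPow k j) : HTensor k 3)
      ⊗ₜ[k[X]] c ∈ LinearMap.range L := fun i j c => ⟨Finsupp.single (i, j) c, by
    simp only [L, Finsupp.lsum_single, LinearMap.restrictScalars_apply,
      TensorProduct.mk_apply]
    rw [pureT_three, map_one, mul_one]⟩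
  -- The range is only known to be a `k`-subspace; stability under multiplication by `F` may be
  -- tested on the spanning elements.
  have hmul : ∀ F : HTensor k 3, (∀ i j c,
      (F * (single k 0 (negDivPow k i) * single k 1 (negDivPow k j)) : HTensor k 3)
        ⊗ₜ[k[X]] c ∈ LinearMap.range L) →
      ∀ z ∈ LinearMap.range L, F • z ∈ LinearMap.range L := by
    rintro F hF _ ⟨f, rfl⟩
    induction f using Finsupp.induction_linear with
    | zero => simp
    | add f g hf hg => rw [map_add, smul_add]; exact add_mem hf hg
    | single ij c =>
      have := hF ij.1 ij.2 c
      rw [← smul_eq_mul, ← TensorProduct.smul_tmul'] at this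
      convert this using 2
      simp only [L, Finsupp.lsum_single, LinearMap.restrictScalars_apply,
        TensorProduct.mk_apply]
      rw [pureT_three, map_one, mul_one]
  have h₀ : ∀ z ∈ LinearMap.range L, single k (0 : Fin 3) Polynomial.X • z ∈ LinearMap.range L :=
    hmul _ fun i j c => by
      rw [← mul_assoc, ← map_mul, X_mul_negDivPow, map_smul, smul_mul_assoc,
        ← TensorProduct.smul_tmul']
      exact Submodule.smul_mem _ _ (hL _ _ _)
  have h₁ : ∀ z ∈ LinearMap.range L, single k (1 : Fin 3) Polynomial.X • z ∈ LinearMap.range L :=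
    hmul _ fun i j c => by
      rw [mul_left_comm, ← map_mul, X_mul_negDivPow, map_smul, mul_smul_comm,
        ← TensorProduct.smul_tmul']
      exact Submodule.smul_mem _ _ (hL _ _ _)
  -- The coproduct of `D` crosses `⊗_H` and is absorbed into `c`.
  have hD : ∀ z ∈ LinearMap.range L, coprod k 3 Polynomial.X • z ∈ LinearMap.range L :=
    hmul _ fun i j c => by
      rw [← smul_def, TensorProduct.smul_tmul]
      exact hL _ _ _
  have hX : ∀ (l : Fin 3), ∀ z ∈ LinearMap.range L,
      single k l Polynomial.X • z ∈ LinearMap.range L := by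
    intro l z hz
    fin_cases l
    · exact h₀ z hz
    · exact h₁ z hz
    -- This is why the third factor can be normalized to 1: `D` there is the full coproduct minus
    -- `D` in the first two places.
    · have e : single k (2 : Fin 3) Polynomial.X = coprod k 3 Polynomial.X
          + (-1 : k) • (single k 0 Polynomial.X + single k 1 Polynomial.X) := by
        rw [coprod_X, Fin.sum_univ_three, neg_one_smul]
        ring
      change single k (2 : Fin 3) Polynomial.X • z ∈ _
      rw [e, add_smul, smul_assoc, add_smul]
      exact add_mem (hD z hz) (Submodule.smul_mem _ _ (add_mem (h₀ z hz) (h₁ z hz)))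
  have hp : ∀ (l : Fin 3) (p : k[X]), ∀ z ∈ LinearMap.range L,
      single k l p • z ∈ LinearMap.range L := by
    intro l p
    induction p using Polynomial.induction_on with
    | C a =>
      intro z hz
      rw [← Polynomial.algebraMap_eq, AlgHom.commutes, algebraMap_smul]
      exact Submodule.smul_mem _ _ hz
    | add p q hp hq =>
      intro z hz
      rw [map_add, add_smul]
      exact add_mem (hp z hz) (hq z hz)
    | monomial i a ih =>
      intro z hz
      rw [pow_succ, ← mul_assoc, map_mul, mul_smul]
      exact ih _ (hX l z hz)
  induction z using TensorProduct.induction_on with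
  | zero => exact zero_mem _
  | add z w hz hw => exact add_mem hz hw
  | tmul F c =>
  induction F using HTensor.induction with
  | ha F G hF hG => rw [TensorProduct.add_tmul]; exact add_mem hF hG
  | hp a h =>
  rw [← TensorProduct.smul_tmul']
  refine Submodule.smul_mem _ _ ?_
  have h1 : (1 : HTensor k 3) ⊗ₜ[k[X]] c ∈ LinearMap.range L := by
    simpa [negDivPow] using hL 0 0 c
  have := hp 0 (h 0) _ (hp 1 (h 1) _ (hp 2 (h 2) _ h1))
  rw [TensorProduct.smul_tmul', TensorProduct.smul_tmul', TensorProduct.smul_tmul', smul_eq_mul,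
    smul_eq_mul, smul_eq_mul, mul_one, ← mul_assoc, ← pureT_three] at this
  convert this using 3
  ext1 i
  fin_cases i <;> rfl

/-- Lexicographic induction on `(i, j)`: at `t^i, t^j, t^{-1}` the lexicographically smaller
coefficients already vanish, and the larger ones carry a zero binomial coefficient. -/
theorem eq_zero_of_evalAt_eq_zero [CharZero k] (z : HTensor k 3 ⊗[k[X]] C)
    (h : ∀ x₁ x₂ x₃ : Laurent k, evalAt C ![x₁, x₂, x₃] z = 0) : z = 0 := by
  obtain ⟨f, rfl⟩ := exists_eq_sum_negDivPow z
  suffices hf : ∀ i j, f (i, j) = 0 by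
    rw [show f = 0 from Finsupp.ext fun ij => hf ij.1 ij.2, Finsupp.sum_zero_index]
  intro i
  induction i using Nat.strong_induction_on with
  | _ i hi =>
  intro j
  induction j using Nat.strong_induction_on with
  | _ j hj =>
  -- The exponent `-1` makes the surviving term `c(-1)`, which determines `c`; nonnegative exponents
  -- are killed by `residue`.
  have h₁ := h (tPow k i) (tPow k j) (tPow k (-1))
  have e : ∀ (i' j' : ℕ) (c : C), evalAt C ![tPow k i, tPow k j, tPow k (-1)]
      (pureT ![negDivPow k i', negDivPow k j', 1] ⊗ₜ[k[X]] c)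
      = ((i.choose i' * j.choose j' : ℕ) : k) • coeff k (i - i' + (j - j') - 1) c := by
    intro i' j' c
    rw [evalAt_tmul, act_pure₃, negDivPow_smul_tPow, negDivPow_smul_tPow, one_smul]
    simp only [map_smul, LinearMap.smul_apply, tMul_tPow, coeffTmul_smul, coeffTmul_tPow,
      smul_smul, Ring.choose_natCast]
    rw [Nat.cast_mul, mul_comm, sub_eq_add_neg _ 1, Int.cast_natCast, Int.cast_natCast]
  rw [Finsupp.sum, map_sum] at h₁
  rw [Finset.sum_eq_single (i, j)] at h₁
  · rw [e] at h₁
    simp only [Nat.choose_self, sub_self, mul_one, Nat.cast_one, one_smul, zero_add, zero_sub] at h₁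
    exact coeff_neg_one_injective (by rw [h₁, map_zero])
  · rintro ⟨i', j'⟩ - hne
    rw [e]
    rcases lt_trichotomy i' i with hlt | rfl | hlt
    · rw [hi i' hlt, map_zero, smul_zero]
    · rcases lt_trichotomy j' j with hlt | rfl | hlt
      · rw [hj j' hlt, map_zero, smul_zero]
      · exact absurd rfl hne
      · rw [Nat.choose_eq_zero_of_lt hlt, mul_zero, Nat.cast_zero, zero_smul]
    · rw [Nat.choose_eq_zero_of_lt hlt, zero_mul, Nat.cast_zero, zero_smul]
  · intro hs
    rw [Finsupp.notMem_support_iff.mp hs, TensorProduct.tmul_zero, map_zero]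

end Injectivity

/-! ### Linearized alternative laws -/

section Alternative

theorem eq_of_sub_eq_sub_swap (k : Type*) [Field k] [CharZero k] {A : Type*} [AddCommGroup A]
    [Module k A] {x y : A} (h : x - y = y - x) : x = y := by
  have h₁ : (2 : k) • (x - y) = 0 := by
    rw [two_smul]
    nth_rewrite 2 [h]
    abel
  exact sub_eq_zero.mp ((smul_eq_zero.mp h₁).resolve_left two_ne_zero)

/-- Polarization: replace `x` by `x + y` and cancel the pure squares. Conversely, equal first two
arguments give twice the associator equal to zero. -/
theorem isLeftAlternative_iff (k : Type*) [Field k] [CharZero k] {A : Type*}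
    [NonUnitalNonAssocRing A] [Module k A] :
    IsLeftAlternative A ↔ ∀ x y z : A, x * (y * z) - x * y * z = y * x * z - y * (x * z) := by
  refine ⟨fun h x y z => ?_, fun h x y => (eq_of_sub_eq_sub_swap k (h x x y)).symm⟩
  have h₁ := h (x + y) z
  simp only [add_mul, mul_add, h x z, h y z] at h₁
  rw [← sub_eq_zero, ← neg_eq_zero, ← sub_eq_zero.mpr h₁]
  abel

theorem isRightAlternative_iff (k : Type*) [Field k] [CharZero k] {A : Type*}
    [NonUnitalNonAssocRing A] [Module k A] :
    IsRightAlternative A ↔ ∀ x y z : A, x * (y * z) - x * y * z = x * z * y - x * (z * y) := by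
  refine ⟨fun h x y z => ?_, fun h x y => eq_of_sub_eq_sub_swap k (h x y y)⟩
  have h₁ := h x (y + z)
  simp only [add_mul, mul_add, h x y, h x z] at h₁
  rw [← sub_eq_zero, ← sub_eq_zero.mpr h₁]
  abel

variable {k : Type u} [Field k] [CharZero k]
variable {C : Type v} [AddCommGroup C] [Module k C] [Module k[X] C] [IsScalarTower k k[X] C]
variable [ConformalAlgebra k C]

/-- The transposition compensates for the exchange of `a` and `b`, so that `x` stays paired with `a`
and `y` with `b`. -/
theorem evalAt_left (x y z : Laurent k) (a b c : C) :
    evalAt C ![x, y, z] (permute k C (Equiv.swap (0 : Fin 3) 1)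
      (pseudoLeft k b a c - pseudoRight k b a c))
      = coeffTmul y b * coeffTmul x a * coeffTmul z c
        - coeffTmul y b * (coeffTmul x a * coeffTmul z c) := by
  rw [evalAt_permute, show ![x, y, z] ∘ Equiv.swap (0 : Fin 3) 1 = ![y, x, z] by
    ext1 i; fin_cases i <;> rfl, map_sub, evalAt_pseudoLeft, evalAt_pseudoRight]

theorem evalAt_right (x y z : Laurent k) (a b c : C) :
    evalAt C ![x, y, z] (permute k C (Equiv.swap (1 : Fin 3) 2)
      (pseudoLeft k a c b - pseudoRight k a c b))
      = coeffTmul x a * coeffTmul z c * coeffTmul y b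
        - coeffTmul x a * (coeffTmul z c * coeffTmul y b) := by
  rw [evalAt_permute, show ![x, y, z] ∘ Equiv.swap (1 : Fin 3) 2 = ![x, z, y] by
    ext1 i; fin_cases i <;> rfl, map_sub, evalAt_pseudoLeft, evalAt_pseudoRight]

theorem evalAt_associator (x y z : Laurent k) (a b c : C) :
    evalAt C ![x, y, z] (pseudoRight k a b c - pseudoLeft k a b c)
      = coeffTmul x a * (coeffTmul y b * coeffTmul z c)
        - coeffTmul x a * coeffTmul y b * coeffTmul z c := by
  rw [map_sub, evalAt_pseudoLeft, evalAt_pseudoRight]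

theorem eq_of_evalAt_eq {z w : HTensor k 3 ⊗[k[X]] C}
    (h : ∀ x₁ x₂ x₃ : Laurent k, evalAt C ![x₁, x₂, x₃] z = evalAt C ![x₁, x₂, x₃] w) : z = w :=
  sub_eq_zero.mp (eq_zero_of_evalAt_eq_zero _ fun x₁ x₂ x₃ => by
    rw [map_sub, h, sub_self])

/-- The linearized law is additive in each of its three arguments, so pure tensors suffice; the
quadratic law itself would not reduce in this way. -/
theorem isLeftAlternative_coeff_iff : IsLeftAlternative (Coeff k C) ↔
    ∀ (x y z : Laurent k) (a b c : C),
      coeffTmul x a * (coeffTmul y b * coeffTmul z c)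
        - coeffTmul x a * coeffTmul y b * coeffTmul z c
      = coeffTmul y b * coeffTmul x a * coeffTmul z c
        - coeffTmul y b * (coeffTmul x a * coeffTmul z c) := by
  rw [isLeftAlternative_iff k]
  refine ⟨fun h x y z a b c => h _ _ _, fun h x y z => ?_⟩
  induction x using Coeff.induction with
  | h0 => simp
  | ha x x' hx hx' =>
    simp only [add_mul, mul_add, add_sub_add_comm, hx, hx']
  | ht x a =>
  induction y using Coeff.induction with
  | h0 => simp
  | ha y y' hy hy' =>
    simp only [add_mul, mul_add, add_sub_add_comm, hy, hy']
  | ht y b =>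
  induction z using Coeff.induction with
  | h0 => simp
  | ha z z' hz hz' =>
    simp only [mul_add, add_sub_add_comm, hz, hz']
  | ht z c => exact h x y z a b c

theorem isRightAlternative_coeff_iff : IsRightAlternative (Coeff k C) ↔
    ∀ (x y z : Laurent k) (a b c : C),
      coeffTmul x a * (coeffTmul y b * coeffTmul z c)
        - coeffTmul x a * coeffTmul y b * coeffTmul z c
      = coeffTmul x a * coeffTmul z c * coeffTmul y b
        - coeffTmul x a * (coeffTmul z c * coeffTmul y b) := by
  rw [isRightAlternative_iff k]
  refine ⟨fun h x y z a b c => h _ _ _, fun h x y z => ?_⟩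
  induction x using Coeff.induction with
  | h0 => simp
  | ha x x' hx hx' =>
    simp only [add_mul, add_sub_add_comm, hx, hx']
  | ht x a =>
  induction y using Coeff.induction with
  | h0 => simp
  | ha y y' hy hy' =>
    simp only [add_mul, mul_add, add_sub_add_comm, hy, hy']
  | ht y b =>
  induction z using Coeff.induction with
  | h0 => simp
  | ha z z' hz hz' =>
    simp only [add_mul, mul_add, add_sub_add_comm, hz, hz']
  | ht z c => exact h x y z a b c

end Alternative

end

end ConformalAlg

/-- A conformal algebra is left (right) alternative if and only if it satisfies the corresponding
identity as a pseudoalgebra. The permutation `σ₁₂` is `Equiv.swap 0 1` and `σ₂₃` is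
`Equiv.swap 1 2`. -/
theorem mainTheorem5 {k : Type*} [Field k] [CharZero k]
    {C : Type*} [AddCommGroup C] [Module k C] [Module k[X] C] [IsScalarTower k k[X] C]
    [ConformalAlg.ConformalAlgebra k C] :
    (ConformalAlg.IsLeftAlternative (ConformalAlg.Coeff k C) ↔
      ∀ a b c : C,
        ConformalAlg.pseudoRight k a b c - ConformalAlg.pseudoLeft k a b c
          = ConformalAlg.permute k C (Equiv.swap (0 : Fin 3) 1)
              (ConformalAlg.pseudoLeft k b a c - ConformalAlg.pseudoRight k b a c)) ∧
    (ConformalAlg.IsRightAlternative (ConformalAlg.Coeff k C) ↔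
      ∀ a b c : C,
        ConformalAlg.pseudoRight k a b c - ConformalAlg.pseudoLeft k a b c
          = ConformalAlg.permute k C (Equiv.swap (1 : Fin 3) 2)
              (ConformalAlg.pseudoLeft k a c b - ConformalAlg.pseudoRight k a c b)) := by
  rw [ConformalAlg.isLeftAlternative_coeff_iff, ConformalAlg.isRightAlternative_coeff_iff]
  -- Passing from `Coeff C` to the pseudoproduct needs joint injectivity; the other direction only
  -- evaluates the given identity.
  refine ⟨⟨fun h a b c => ConformalAlg.eq_of_evalAt_eq fun x y z => ?_, fun h x y z a b c => ?_⟩,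
    ⟨fun h a b c => ConformalAlg.eq_of_evalAt_eq fun x y z => ?_, fun h x y z a b c => ?_⟩⟩
  · rw [ConformalAlg.evalAt_associator, ConformalAlg.evalAt_left, h]
  · rw [← ConformalAlg.evalAt_associator, ← ConformalAlg.evalAt_left, h]
  · rw [ConformalAlg.evalAt_associator, ConformalAlg.evalAt_right, h]
  · rw [← ConformalAlg.evalAt_associator, ← ConformalAlg.evalAt_right, h]
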